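/- Let $n\ge 2$ and let $L(\mathbf{x},\mathbf{v})$ be a continuous real-valued function on $\mathbb{R}^n\times\mathbb{R}^n$ that is $C^2$ on the open set $\mathbb{R}^n\times(\mathbb{R}^n\setminus\{\mathbf{0}\})$ and which, on this open set, satisfies Hamel's system of differential equations $$ \frac{\partial^2 L}{\partial x_i\,\partial v_j}=\frac{\partial^2 L}{\partial x_j\,\partial v_i}\qquad(1\le i,j\le n). $$ If $L(\mathbf{x}+\mathbf{m},\lambda\mathbf{v})=\lambda L(\mathbf{x},\mathbf{v})$ for all $\mathbf{x},\mathbf{v}\in\mathbb{R}^n$, all $\lambda>0$ and all integer vectors $\mathbf{m}\in\mathbb{Z}^n$, then there exists a $C^3$ function $f:\mathbb{R}^n\to\mathbb{R}$ such that $L(\mathbf{x},\mathbf{v})-df(\mathbf{x})\cdot\mathbf{v}$ is independent of the variable $\mathbf{x}$. -/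

import Mathlib

/-- The partial derivative `∂L/∂x_i` of a function `L(x, v)` on `ℝⁿ × ℝⁿ`. -/
noncomputable def partialX {n : ℕ} (i : Fin n) (L : (Fin n → ℝ) × (Fin n → ℝ) → ℝ) :
    (Fin n → ℝ) × (Fin n → ℝ) → ℝ :=
  fun p => fderiv ℝ L p (Pi.single i 1, 0)

/-- The partial derivative `∂L/∂v_j` of a function `L(x, v)` on `ℝⁿ × ℝⁿ`. -/
noncomputable def partialV {n : ℕ} (j : Fin n) (L : (Fin n → ℝ) × (Fin n → ℝ) → ℝ) :
    (Fin n → ℝ) × (Fin n → ℝ) → ℝ :=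
  fun p => fderiv ℝ L p (0, Pi.single j 1)

/-- Hamel's equations `∂²L/∂x_i∂v_j = ∂²L/∂x_j∂v_i` at all points `(x, v)` with `v ≠ 0`. -/
def HamelEquations {n : ℕ} (L : (Fin n → ℝ) × (Fin n → ℝ) → ℝ) : Prop :=
  ∀ (i j : Fin n) (x v : Fin n → ℝ), v ≠ 0 →
    partialX i (partialV j L) (x, v) = partialX j (partialV i L) (x, v)

/-! Write `p = ∂L/∂v`. Hamel's equations and Euler's identity make straight lines extremal, so the
action of `L` over the segment from `x` to `x + v` has only endpoint terms in its derivative.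
Symmetry of the second derivative of this action gives `∂²L/∂v²` the same value at `(x + v, v)` and
`(x, v)`. Combined with periodicity and a small perturbation of `v`, this makes the Hessian
independent of `x`.

Since the punctured space is connected for `n ≥ 2`, `p(x, v) - p(0, v)` is then a covector `ω x` not
depending on `v`, and Euler's identity gives `L (x, v) - L (0, v) = ω x v`. Hamel's equations say
that `ω` is closed, hence `ω = df`. -/

open Set Filter Topology

section ParametricIntegral

variable {H : Type*} [NormedAddCommGroup H] [NormedSpace ℝ H] [ProperSpace H]

/-- Differentiation under the integral sign for a parametric integral with jointly continuous
derivative. -/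
theorem hasFDerivAt_intervalIntegral_of_continuousOn {U : Set H} (hU : IsOpen U)
    {f : H → ℝ → ℝ} {f' : H → ℝ → H →L[ℝ] ℝ} (a b : ℝ)
    (hf : ContinuousOn (fun p : H × ℝ => f p.1 p.2) (U ×ˢ univ))
    (hf' : ContinuousOn (fun p : H × ℝ => f' p.1 p.2) (U ×ˢ univ))
    (hderiv : ∀ x ∈ U, ∀ t, HasFDerivAt (fun y => f y t) (f' x t) x) {x : H} (hx : x ∈ U) :
    HasFDerivAt (fun y => ∫ t in a..b, f y t) (∫ t in a..b, f' x t) x := by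
  obtain ⟨ε, hε, hball⟩ := Metric.nhds_basis_closedBall.mem_iff.1 (hU.mem_nhds hx)
  have hslice : ∀ y ∈ U, Continuous (f y) := fun y hy =>
    hf.comp_continuous (f := fun t : ℝ => (y, t)) (by fun_prop) fun t => ⟨hy, mem_univ t⟩
  have hslice' : Continuous (f' x) :=
    hf'.comp_continuous (f := fun t : ℝ => (x, t)) (by fun_prop) fun t => ⟨hx, mem_univ t⟩
  obtain ⟨C, hC⟩ := ((isCompact_closedBall x ε).prod (isCompact_uIcc (a := a) (b := b))
    ).exists_bound_of_continuousOn (hf'.mono (prod_mono hball (subset_univ _)))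
  refine intervalIntegral.hasFDerivAt_integral_of_dominated_of_fderiv_le
    (F' := f') (bound := fun _ => C) (Metric.closedBall_mem_nhds x hε) ?_
    ((hslice x hx).intervalIntegrable a b) hslice'.aestronglyMeasurable ?_
    intervalIntegrable_const ?_
  · filter_upwards [hU.mem_nhds hx] with y hy using (hslice y hy).aestronglyMeasurable
  · exact .of_forall fun t ht y hy => hC (y, t) ⟨hy, uIoc_subset_uIcc ht⟩
  · exact .of_forall fun t _ y hy => hderiv y (hball hy) t

end ParametricIntegral

/-! ### Action along segments and invariance of the Hessian -/

section Hamel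

variable {E : Type*} [NormedAddCommGroup E] [NormedSpace ℝ E]

/-- Hamel's equations `∂²L/∂x∂v (a, b) = ∂²L/∂x∂v (b, a)` at `(x, v)` with `v ≠ 0`, in
coordinate-free form. -/
def IsHamel (L : E × E → ℝ) : Prop :=
  ∀ (x v : E), v ≠ 0 → ∀ a b : E,
    fderiv ℝ (fderiv ℝ L) (x, v) (a, 0) (0, b) = fderiv ℝ (fderiv ℝ L) (x, v) (b, 0) (0, a)

omit [NormedSpace ℝ E] in
theorem isOpen_snd_ne_zero : IsOpen {p : E × E | p.2 ≠ 0} :=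
  isOpen_ne.preimage continuous_snd

section Smooth

variable {L : E × E → ℝ} (hL : ContDiffOn ℝ 2 L {p | p.2 ≠ 0})
include hL

theorem contDiffOn_fderiv_of_snd_ne_zero : ContDiffOn ℝ 1 (fderiv ℝ L) {p | p.2 ≠ 0} :=
  hL.fderiv_of_isOpen isOpen_snd_ne_zero (by norm_num)

theorem hasFDerivAt_of_snd_ne_zero {p : E × E} (hp : p.2 ≠ 0) :
    HasFDerivAt L (fderiv ℝ L p) p :=
  ((hL.contDiffAt (isOpen_snd_ne_zero.mem_nhds hp)).differentiableAt (by norm_num)).hasFDerivAt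

theorem hasFDerivAt_fderiv_of_snd_ne_zero {p : E × E} (hp : p.2 ≠ 0) :
    HasFDerivAt (fderiv ℝ L) (fderiv ℝ (fderiv ℝ L) p) p :=
  (((contDiffOn_fderiv_of_snd_ne_zero hL).contDiffAt
    (isOpen_snd_ne_zero.mem_nhds hp)).differentiableAt (by norm_num)).hasFDerivAt

theorem continuousOn_fderiv_fderiv_of_snd_ne_zero :
    ContinuousOn (fderiv ℝ (fderiv ℝ L)) {p | p.2 ≠ 0} :=
  (contDiffOn_fderiv_of_snd_ne_zero hL).continuousOn_fderiv_of_isOpen isOpen_snd_ne_zero le_rfl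

/-- Euler's identity for functions that are positively homogeneous in the second variable. -/
theorem fderiv_apply_self_of_homogeneous
    (hhom : ∀ (c : ℝ), 0 < c → ∀ x v, L (x, c • v) = c * L (x, v)) {x v : E} (hv : v ≠ 0) :
    fderiv ℝ L (x, v) (0, v) = L (x, v) := by
  have h1 : HasDerivAt (fun c : ℝ => (x, c • v)) (0, v) 1 := by
    simpa using (hasDerivAt_const (1 : ℝ) x).prodMk ((hasDerivAt_id (1 : ℝ)).smul_const v)
  have h2 : HasDerivAt (fun c : ℝ => L (x, c • v)) (fderiv ℝ L (x, v) (0, v)) 1 := by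
    have h0 : HasFDerivAt L (fderiv ℝ L (x, v)) ((fun c : ℝ => (x, c • v)) 1) := by
      simpa using hasFDerivAt_of_snd_ne_zero hL (p := (x, v)) hv
    exact h0.comp_hasDerivAt 1 h1
  have h3 : HasDerivAt (fun c : ℝ => L (x, c • v)) (L (x, v)) 1 := by
    have h4 : HasDerivAt (fun c : ℝ => c * L (x, v)) (L (x, v)) 1 := by
      simpa using (hasDerivAt_id (1 : ℝ)).mul_const (L (x, v))
    refine h4.congr_of_eventuallyEq ?_
    filter_upwards [lt_mem_nhds (zero_lt_one' ℝ)] with c hc using hhom c hc x v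
  exact h2.unique h3

/-- The derivative in the first variable of Euler's identity. -/
theorem fderiv_fderiv_apply_self_of_homogeneous
    (hhom : ∀ (c : ℝ), 0 < c → ∀ x v, L (x, c • v) = c * L (x, v)) {x v : E} (hv : v ≠ 0)
    (a : E) :
    fderiv ℝ (fderiv ℝ L) (x, v) (a, 0) (0, v) = fderiv ℝ L (x, v) (a, 0) := by
  have hx : HasFDerivAt (fun y : E => (y, v)) (ContinuousLinearMap.inl ℝ E E) x :=
    hasFDerivAt_prodMk_left x v
  have h1 := ((hasFDerivAt_fderiv_of_snd_ne_zero hL (p := (x, v)) hv).comp x hx).clm_apply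
    (hasFDerivAt_const ((0, v) : E × E) x)
  have h2 := (hasFDerivAt_of_snd_ne_zero hL (p := (x, v)) hv).comp x hx
  have h3 : (fun y => (fderiv ℝ L ∘ fun y : E => (y, v)) y (0, v)) = L ∘ fun y : E => (y, v) :=
    funext fun y => fderiv_apply_self_of_homogeneous hL hhom hv
  rw [h3] at h1
  simpa using DFunLike.congr_fun (h1.unique h2) a

/-- The mixed second derivatives of a positively homogeneous solution of Hamel's equations
satisfy the Euler–Lagrange equations along straight lines. -/
theorem IsHamel.fderiv_fderiv_self (hH : IsHamel L)
    (hhom : ∀ (c : ℝ), 0 < c → ∀ x v, L (x, c • v) = c * L (x, v)) {x v : E} (hv : v ≠ 0)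
    (a : E) :
    fderiv ℝ (fderiv ℝ L) (x, v) (v, 0) (0, a) = fderiv ℝ L (x, v) (a, 0) := by
  rw [hH x v hv, fderiv_fderiv_apply_self_of_homogeneous hL hhom hv]

/-- First variation formula for the integral of `L` along the segment from `x` to `x + v`. -/
theorem IsHamel.hasFDerivAt_segment_integral [FiniteDimensional ℝ E] (hH : IsHamel L)
    (hhom : ∀ (c : ℝ), 0 < c → ∀ x v, L (x, c • v) = c * L (x, v)) {p : E × E} (hp : p.2 ≠ 0) :
    HasFDerivAt (fun q : E × E => ∫ t in (0 : ℝ)..1, L (q.1 + t • q.2, q.2))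
      ((fderiv ℝ L (p.1 + p.2, p.2)).comp ((ContinuousLinearMap.inr ℝ E E).comp
          (ContinuousLinearMap.fst ℝ E E + ContinuousLinearMap.snd ℝ E E))
        - (fderiv ℝ L p).comp ((ContinuousLinearMap.inr ℝ E E).comp
          (ContinuousLinearMap.fst ℝ E E))) p := by
  let A : ℝ → E × E →L[ℝ] E × E := fun t =>
    ContinuousLinearMap.id ℝ (E × E) +
      t • (ContinuousLinearMap.inl ℝ E E).comp (ContinuousLinearMap.snd ℝ E E)
  have hA : ∀ t (q : E × E), A t q = (q.1 + t • q.2, q.2) := fun t q => by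
    ext <;> simp [A]
  have hAc : Continuous A := by fun_prop
  have hmaps : MapsTo (fun r : (E × E) × ℝ => A r.2 r.1) ({q | q.2 ≠ 0} ×ˢ univ)
      {q : E × E | q.2 ≠ 0} := fun r hr => by simpa [hA] using hr.1
  have hAr : Continuous fun r : (E × E) × ℝ => A r.2 r.1 := by fun_prop
  have hint := hasFDerivAt_intervalIntegral_of_continuousOn (isOpen_snd_ne_zero (E := E))
    (f := fun q t => L (A t q)) (f' := fun q t => (fderiv ℝ L (A t q)).comp (A t)) 0 1
    (hL.continuousOn.comp hAr.continuousOn hmaps)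
    (((contDiffOn_fderiv_of_snd_ne_zero hL).continuousOn.comp hAr.continuousOn hmaps).clm_comp
      (hAc.comp continuous_snd).continuousOn)
    (fun q hq t => (hasFDerivAt_of_snd_ne_zero hL (p := A t q) (by simpa [hA] using hq)).comp q
      (A t).hasFDerivAt) hp
  simp only [hA] at hint
  refine hint.congr_fderiv ?_
  have hc : Continuous fun t : ℝ => (fderiv ℝ L (p.1 + t • p.2, p.2)).comp (A t) := by
    refine Continuous.clm_comp ?_ hAc
    exact (contDiffOn_fderiv_of_snd_ne_zero hL).continuousOn.comp_continuous
      (f := fun t : ℝ => (p.1 + t • p.2, p.2)) (by fun_prop) fun t => hp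
  refine ContinuousLinearMap.ext fun w => ?_
  rw [ContinuousLinearMap.intervalIntegral_apply (hc.intervalIntegrable 0 1)]
  -- By the Euler–Lagrange identity the integrand is a total derivative in `t`, so only the
  -- endpoints contribute.
  have hder : ∀ t : ℝ, HasDerivAt
      (fun t : ℝ => fderiv ℝ L (p.1 + t • p.2, p.2) (0, w.1 + t • w.2))
      (((fderiv ℝ L (p.1 + t • p.2, p.2)).comp (A t)) w) t := by
    intro t
    have h1 : HasDerivAt (fun t : ℝ => (p.1 + t • p.2, p.2)) (p.2, 0) t := by
      simpa using (((hasDerivAt_id t).smul_const p.2).const_add p.1).prodMk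
        (hasDerivAt_const t p.2)
    have h2 : HasDerivAt (fun t : ℝ => ((0 : E), w.1 + t • w.2)) (0, w.2) t := by
      simpa using (hasDerivAt_const t (0 : E)).prodMk
        (((hasDerivAt_id t).smul_const w.2).const_add w.1)
    have h0 : HasDerivAt (fun t : ℝ => fderiv ℝ L (p.1 + t • p.2, p.2))
        (fderiv ℝ (fderiv ℝ L) (p.1 + t • p.2, p.2) (p.2, 0)) t :=
      HasFDerivAt.comp_hasDerivAt (l := fderiv ℝ L) (f := fun t : ℝ => (p.1 + t • p.2, p.2)) t
        (hasFDerivAt_fderiv_of_snd_ne_zero hL (p := (p.1 + t • p.2, p.2)) hp) h1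
    refine (h0.clm_apply h2).congr_deriv ?_
    rw [hH.fderiv_fderiv_self hL hhom hp, ContinuousLinearMap.comp_apply, hA, ← map_add]
    simp
  rw [intervalIntegral.integral_eq_sub_of_hasDerivAt (fun t _ => hder t)
    ((hc.clm_apply continuous_const).intervalIntegrable 0 1)]
  simp [← map_add]

/-- The Hessian in the second variable of a positively homogeneous solution of Hamel's equations
is invariant under translation of the first variable along the second one. -/
theorem IsHamel.hessian_add_self [FiniteDimensional ℝ E] (hH : IsHamel L)
    (hhom : ∀ (c : ℝ), 0 < c → ∀ x v, L (x, c • v) = c * L (x, v)) {x v : E} (hv : v ≠ 0)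
    (a b : E) :
    fderiv ℝ (fderiv ℝ L) (x + v, v) (0, a) (0, b) =
      fderiv ℝ (fderiv ℝ L) (x, v) (0, a) (0, b) := by
  let T : E × E →L[ℝ] E × E := ContinuousLinearMap.id ℝ (E × E) +
      (ContinuousLinearMap.inl ℝ E E).comp (ContinuousLinearMap.snd ℝ E E)
  have hT : ∀ q, T q = (q.1 + q.2, q.2) := fun q => by ext <;> simp [T]
  have h1 : HasFDerivAt (fun q : E × E => fderiv ℝ L (q.1 + q.2, q.2))
      ((fderiv ℝ (fderiv ℝ L) (x + v, v)).comp T) (x, v) := by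
    have h0 := hasFDerivAt_fderiv_of_snd_ne_zero hL (p := T (x, v)) (by simpa [hT] using hv)
    simpa only [hT, Function.comp_def] using h0.comp (x, v) T.hasFDerivAt
  have h2 := (h1.clm_comp (hasFDerivAt_const ((ContinuousLinearMap.inr ℝ E E).comp
      (ContinuousLinearMap.fst ℝ E E + ContinuousLinearMap.snd ℝ E E)) (x, v))).sub
    ((hasFDerivAt_fderiv_of_snd_ne_zero hL (p := (x, v)) hv).clm_comp
      (hasFDerivAt_const ((ContinuousLinearMap.inr ℝ E E).comp
      (ContinuousLinearMap.fst ℝ E E)) (x, v)))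
  have h3 : ∀ᶠ q in 𝓝 (x, v), q.2 ≠ 0 := isOpen_snd_ne_zero.mem_nhds hv
  -- The variation `(-a, a)` fixes the endpoint `x + v`; the mixed derivatives left over at `x`
  -- cancel by `h5`.
  have h4 := second_derivative_symmetric_of_eventually
    (h3.mono fun q hq => hH.hasFDerivAt_segment_integral hL hhom hq) h2 (-a, a) (b, 0)
  have h5 := hH x v hv a b
  have h6 : ((-a, a) : E × E) = (0, a) - (a, 0) := by simp
  have h7 : ((0, -a) : E × E) = -(0, a) := by simp
  simp [hT] at h4
  simp only [h6, h7, map_sub, map_neg, sub_apply, Prod.mk_zero_zero, map_zero] at h4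
  linarith

theorem IsHamel.hessian_add_nsmul [FiniteDimensional ℝ E] (hH : IsHamel L)
    (hhom : ∀ (c : ℝ), 0 < c → ∀ x v, L (x, c • v) = c * L (x, v)) {x v : E} (hv : v ≠ 0)
    (a b : E) (N : ℕ) :
    fderiv ℝ (fderiv ℝ L) (x + N • v, v) (0, a) (0, b) =
      fderiv ℝ (fderiv ℝ L) (x, v) (0, a) (0, b) := by
  induction N with
  | zero => simp
  | succ N ih => rw [succ_nsmul, ← add_assoc, hH.hessian_add_self hL hhom hv, ih]

end Smooth

end Hamel

/-! ### Independence of the base point on the torus -/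

section Periodic

variable {n : ℕ}

theorem tendsto_intFloor_mul_natCast_div (a : ℝ) :
    Tendsto (fun N : ℕ => (⌊a * N⌋ : ℝ) / N) atTop (𝓝 a) := by
  have h1 : Tendsto (fun N : ℕ => a - 1 / (N : ℝ)) atTop (𝓝 a) := by
    simpa using tendsto_const_nhds.sub (tendsto_one_div_atTop_nhds_zero_nat (𝕜 := ℝ))
  refine tendsto_of_tendsto_of_tendsto_of_le_of_le' h1 tendsto_const_nhds ?_ ?_
  · filter_upwards [eventually_gt_atTop 0] with N hN
    have hN' : (0 : ℝ) < N := by exact_mod_cast hN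
    rw [le_div_iff₀ hN', sub_mul, one_div, inv_mul_cancel₀ hN'.ne']
    exact (Int.sub_one_lt_floor _).le
  · filter_upwards [eventually_gt_atTop 0] with N hN
    have hN' : (0 : ℝ) < N := by exact_mod_cast hN
    rw [div_le_iff₀ hN']
    exact Int.floor_le _

/-- A continuous function `g (x, v)` on the punctured tangent bundle of the torus that is invariant
under the translations `x ↦ x + N v` is independent of `x`. -/
theorem eq_of_periodic_of_add_nsmul {g : (Fin n → ℝ) × (Fin n → ℝ) → ℝ}
    (hg : ContinuousOn g {p | p.2 ≠ 0})
    (hper : ∀ (m : Fin n → ℤ) x v, g (x + fun i => (m i : ℝ), v) = g (x, v))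
    (hinv : ∀ x v, v ≠ 0 → ∀ N : ℕ, g (x + N • v, v) = g (x, v)) (x y : Fin n → ℝ)
    {v : Fin n → ℝ} (hv : v ≠ 0) : g (x, v) = g (y, v) := by
  -- Perturbation of `v` for which `x + N • w N` is exactly `y` plus an integer vector.
  let w : ℕ → Fin n → ℝ := fun N i => (y i - x i) / N + (⌊v i * N⌋ : ℝ) / N
  have hw : Tendsto w atTop (𝓝 v) := tendsto_pi_nhds.2 fun i => by
    simpa using (tendsto_const_div_atTop_nhds_zero_nat (y i - x i)).add
      (tendsto_intFloor_mul_natCast_div (v i))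
  have hlim : ∀ z : Fin n → ℝ, Tendsto (fun N => g (z, w N)) atTop (𝓝 (g (z, v))) := fun z =>
    (hg.continuousAt (isOpen_snd_ne_zero.mem_nhds hv)).tendsto.comp
      (tendsto_const_nhds.prodMk_nhds hw)
  refine tendsto_nhds_unique_of_eventuallyEq (hlim x) (hlim y) ?_
  filter_upwards [hw.eventually_ne hv, eventually_gt_atTop 0] with N hwN hN
  have hN' : (N : ℝ) ≠ 0 := by exact_mod_cast hN.ne'
  have h1 : x + N • w N = y + fun i => ((⌊v i * N⌋ : ℤ) : ℝ) := by
    ext i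
    change x i + N • ((y i - x i) / N + (⌊v i * N⌋ : ℝ) / N) = y i + (⌊v i * N⌋ : ℝ)
    rw [nsmul_eq_mul]
    field_simp
    ring
  rw [← hinv x _ hwN N, h1, hper]

/-- Both sides are bilinear in `(a, b)`, so basis vectors suffice. -/
theorem HamelEquations.isHamel {L : (Fin n → ℝ) × (Fin n → ℝ) → ℝ}
    (hL : ContDiffOn ℝ 2 L {p | p.2 ≠ 0}) (hH : HamelEquations L) : IsHamel L := by
  intro x v hv a b
  let D := fderiv ℝ (fderiv ℝ L) (x, v)
  have hpart : ∀ i j : Fin n, partialX i (partialV j L) (x, v) =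
      D (Pi.single i 1, 0) (0, Pi.single j 1) := by
    intro i j
    have h := (hasFDerivAt_fderiv_of_snd_ne_zero hL (p := (x, v)) hv).clm_apply
      (hasFDerivAt_const ((0, Pi.single j 1) : (Fin n → ℝ) × (Fin n → ℝ)) (x, v))
    unfold partialX partialV
    rw [h.fderiv]
    simp [D]
  let B : (Fin n → ℝ) →ₗ[ℝ] (Fin n → ℝ) →ₗ[ℝ] ℝ :=
    LinearMap.mk₂ ℝ (fun a b => D (a, 0) (0, b))
      (fun a a' b => by
        rw [show ((a + a', 0) : (Fin n → ℝ) × (Fin n → ℝ)) = (a, 0) + (a', 0) by simp, map_add,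
          add_apply])
      (fun c a b => by
        rw [show ((c • a, 0) : (Fin n → ℝ) × (Fin n → ℝ)) = c • (a, 0) by simp, map_smul,
          smul_apply])
      (fun a b b' => by
        rw [show ((0, b + b') : (Fin n → ℝ) × (Fin n → ℝ)) = (0, b) + (0, b') by simp, map_add])
      (fun c a b => by
        rw [show ((0, c • b) : (Fin n → ℝ) × (Fin n → ℝ)) = c • (0, b) by simp, map_smul])
  have hB : B = B.flip := by
    refine (Pi.basisFun ℝ (Fin n)).ext fun i => (Pi.basisFun ℝ (Fin n)).ext fun j => ?_
    simpa [B, hpart] using hH i j x v hv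
  exact LinearMap.congr_fun (LinearMap.congr_fun hB a) b

variable {L : (Fin n → ℝ) × (Fin n → ℝ) → ℝ}

theorem IsHamel.hessian_eq (hH : IsHamel L) (hL : ContDiffOn ℝ 2 L {p | p.2 ≠ 0})
    (hhom : ∀ (c : ℝ), 0 < c → ∀ x v, L (x, c • v) = c * L (x, v))
    (hper : ∀ (m : Fin n → ℤ) x v, L (x + fun i => (m i : ℝ), v) = L (x, v))
    (x y : Fin n → ℝ) {v : Fin n → ℝ} (hv : v ≠ 0) (a b : Fin n → ℝ) :
    fderiv ℝ (fderiv ℝ L) (x, v) (0, a) (0, b) = fderiv ℝ (fderiv ℝ L) (y, v) (0, a) (0, b) := by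
  refine eq_of_periodic_of_add_nsmul
    (g := fun p => fderiv ℝ (fderiv ℝ L) p (0, a) (0, b))
    (((continuousOn_fderiv_fderiv_of_snd_ne_zero hL).clm_apply continuousOn_const).clm_apply
      continuousOn_const) (fun m x v => ?_)
    (fun x v hv N => hH.hessian_add_nsmul hL hhom hv a b N) x y hv
  have h0 : (fun q => L (q + (fun i => (m i : ℝ), 0))) = L :=
    funext fun q => by
      rw [← hper m q.1 q.2]
      exact congrArg L (Prod.ext rfl (add_zero q.2))
  have h1 : (fun q => fderiv ℝ L (q + (fun i => (m i : ℝ), 0))) = fderiv ℝ L :=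
    funext fun q => by rw [← fderiv_comp_add_right, h0]
  have h2 := fderiv_comp_add_right (𝕜 := ℝ) (f := fderiv ℝ L) (x := (x, v)) (fun i => (m i : ℝ), 0)
  rw [h1] at h2
  simp [h2]

/-- The difference of the momenta at two base points does not depend on the direction. -/
theorem IsHamel.momentum_sub_eq (hn : 2 ≤ n) (hH : IsHamel L)
    (hL : ContDiffOn ℝ 2 L {p | p.2 ≠ 0})
    (hhom : ∀ (c : ℝ), 0 < c → ∀ x v, L (x, c • v) = c * L (x, v))
    (hper : ∀ (m : Fin n → ℤ) x v, L (x + fun i => (m i : ℝ), v) = L (x, v))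
    (x y : Fin n → ℝ) {v w : Fin n → ℝ} (hv : v ≠ 0) (hw : w ≠ 0) :
    (fderiv ℝ L (x, v) - fderiv ℝ L (y, v)).comp
        (ContinuousLinearMap.inr ℝ (Fin n → ℝ) (Fin n → ℝ)) =
      (fderiv ℝ L (x, w) - fderiv ℝ L (y, w)).comp
        (ContinuousLinearMap.inr ℝ (Fin n → ℝ) (Fin n → ℝ)) := by
  -- The only place where `2 ≤ n` is essential.
  have hconn : IsPreconnected ({0}ᶜ : Set (Fin n → ℝ)) :=
    (isConnected_compl_singleton_of_one_lt_rank (by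
      rw [rank_fin_fun]; exact_mod_cast hn) 0).isPreconnected
  have hd : ∀ u ∈ ({0}ᶜ : Set (Fin n → ℝ)), HasFDerivAt (𝕜 := ℝ)
      (fun u : Fin n → ℝ => (fderiv ℝ L (x, u) - fderiv ℝ L (y, u)).comp
        (ContinuousLinearMap.inr ℝ (Fin n → ℝ) (Fin n → ℝ))) 0 u := by
    intro u hu
    have h : ∀ z : Fin n → ℝ, HasFDerivAt (fun u => fderiv ℝ L (z, u))
        ((fderiv ℝ (fderiv ℝ L) (z, u)).comp
          (ContinuousLinearMap.inr ℝ (Fin n → ℝ) (Fin n → ℝ))) u := fun z =>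
      (hasFDerivAt_fderiv_of_snd_ne_zero hL (p := (z, u)) hu).comp u (hasFDerivAt_prodMk_right z u)
    have h' := ((h x).sub (h y)).clm_comp (hasFDerivAt_const
      (ContinuousLinearMap.inr ℝ (Fin n → ℝ) (Fin n → ℝ)) u)
    refine h'.congr_fderiv ?_
    refine ContinuousLinearMap.ext fun a => ContinuousLinearMap.ext fun b => ?_
    simpa [sub_eq_zero] using hH.hessian_eq hL hhom hper x y hu a b
  exact isOpen_compl_singleton.is_const_of_fderiv_eq_zero hconn
    (fun u hu => (hd u hu).differentiableAt.differentiableWithinAt)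
    (fun u hu => (hd u hu).fderiv) hv hw

end Periodic

/-! ### The closed form and its potential -/

theorem mainTheorem4 (n : ℕ) (hn : 2 ≤ n)
    (L : (Fin n → ℝ) × (Fin n → ℝ) → ℝ)
    (hcont : Continuous L)
    (hC2 : ContDiffOn ℝ 2 L {p | p.2 ≠ 0})
    (hHamel : HamelEquations L)
    (hper : ∀ (m : Fin n → ℤ) (c : ℝ), 0 < c → ∀ x v : Fin n → ℝ,
      L (x + (fun i => (m i : ℝ)), c • v) = c * L (x, v)) :
    ∃ f : (Fin n → ℝ) → ℝ, ContDiff ℝ 3 f ∧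
      ∀ x y v : Fin n → ℝ,
        L (x, v) - fderiv ℝ f x v = L (y, v) - fderiv ℝ f y v := by
  have hH := hHamel.isHamel hC2
  have hhom : ∀ (c : ℝ), 0 < c → ∀ x v, L (x, c • v) = c * L (x, v) := fun c hc x v => by
    simpa [← Pi.zero_def] using hper 0 c hc x v
  have hper' : ∀ (m : Fin n → ℤ) x v, L (x + fun i => (m i : ℝ), v) = L (x, v) :=
    fun m x v => by simpa using hper m 1 one_pos x v
  have hzero : ∀ x, L (x, 0) = 0 := fun x => by
    have := hhom 2 two_pos x 0
    rw [smul_zero] at this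
    linarith
  -- Any nonzero direction would serve to define `ω`.
  let e : Fin n → ℝ := fun _ => 1
  have he : e ≠ 0 := fun h => one_ne_zero (congrFun h ⟨0, by omega⟩)
  let ω : (Fin n → ℝ) → (Fin n → ℝ) →L[ℝ] ℝ := fun x =>
    (fderiv ℝ L (x, e) - fderiv ℝ L (0, e)).comp (ContinuousLinearMap.inr ℝ _ _)
  have hω : ∀ x v, ω x v = L (x, v) - L (0, v) := by
    intro x v
    rcases eq_or_ne v 0 with rfl | hv
    · simp [hzero]
    · rw [← fderiv_apply_self_of_homogeneous hC2 hhom hv,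
        ← fderiv_apply_self_of_homogeneous hC2 hhom hv]
      simpa [ω] using DFunLike.congr_fun (hH.momentum_sub_eq hn hC2 hhom hper' x 0 he hv) v
  -- The definition of `ω` through `fderiv ℝ L` shows only `C^1`; the extra derivative comes from
  -- `hω`.
  have hω2 : ContDiff ℝ 2 ω := contDiff_clm_apply_iff.2 fun v => by
    simp only [hω]
    rcases eq_or_ne v 0 with rfl | hv
    · simpa [hzero] using contDiff_const
    · refine ContDiff.sub ?_ contDiff_const
      exact hC2.comp_contDiff (f := fun x => (x, v)) (by fun_prop) fun _ => hv
  have hωd : ∀ x a b, fderiv ℝ ω x a b = fderiv ℝ (fderiv ℝ L) (x, e) (a, 0) (0, b) := by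
    intro x a b
    have h := (((hasFDerivAt_fderiv_of_snd_ne_zero hC2 (p := (x, e)) he).comp x
      (hasFDerivAt_prodMk_left x e)).sub_const (fderiv ℝ L (0, e))).clm_comp
      (hasFDerivAt_const (ContinuousLinearMap.inr ℝ (Fin n → ℝ) (Fin n → ℝ)) x)
    have h' : fderiv ℝ ω x = _ := h.fderiv
    rw [h']
    simp
  obtain ⟨f, hf⟩ := convex_univ.exists_forall_hasFDerivAt_of_fderiv_symmetric isOpen_univ
    (hω2.differentiable (by norm_num)).differentiableOn fun x _ a b => by
      rw [hωd, hωd, hH x e he]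
  refine ⟨f, ?_, fun x y v => ?_⟩
  · exact contDiff_succ_iff_hasFDerivAt (n := 2).2 ⟨ω, hω2, fun x => hf x (mem_univ x)⟩
  · rw [(hf x (mem_univ x)).fderiv, (hf y (mem_univ y)).fderiv, hω, hω]
    ring
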